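/- Let $S=\mathbb{C}[x,y,z]$ and let $C:f=0$ be a reduced plane curve in $\mathbb{P}^2$ of degree $d\ge 3$, i.e. $f\in S$ is homogeneous of degree $d$ and squarefree. Let $J_f=(f_x,f_y,f_z)$ be the Jacobian ideal, $M(f)=S/J_f$ the Jacobian algebra, $I_f$ the saturation of $J_f$ with respect to $(x,y,z)$, and $\tau(C)$ the total Tjurina number of $C$, i.e. the sum of the Tjurina numbers of all singularities of $C$. For $k\ge 0$ let $$\operatorname{def}_k\Sigma_f=\tau(C)-\dim_{\mathbb{C}} (S/I_f)_k$$ be the defect of the singular subscheme $\Sigma_f$, which is defined by $I_f$. Assume that $C$ is free with exponents $(d_1,d_2)$, i.e. the graded $S$-module $D_0(f)=\{(a,b,c)\in S^3 : af_x+bf_y+cf_z=0\}$ has a minimal set of homogeneous generators consisting of two elements, of degrees $d_1\le d_2$. Then $k_1=2d-5-d_1$ is non-negative, $$\operatorname{def}_k\Sigma_f=\tau(C)-\dim_{\mathbb{C}} M(f)_k=0\quad\text{for every } k>k_1,$$ and $$\operatorname{def}_{k_1}\Sigma_f=\tau(C)-\dim_{\mathbb{C}} M(f)_{k_1}>0.$$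 -/

import Mathlib

namespace PlaneCurve

open MvPolynomial
open scoped LinearAlgebra.Projectivization

/-- The polynomial ring `S = ℂ[x, y, z]`. -/
abbrev S : Type := MvPolynomial (Fin 3) ℂ

/-- The Jacobian ideal `J_f`, spanned by the partial derivatives `f_x, f_y, f_z`. -/
noncomputable def jacobianIdeal (f : S) : Ideal S :=
  Ideal.span (Set.range fun i : Fin 3 => pderiv i f)

/-- The saturation of an ideal of `S` with respect to `𝔪 = (x, y, z)`: the polynomials `g` such
that `𝔪 ^ n * g` is contained in the ideal for some `n`. -/
noncomputable def saturation (J : Ideal S) : Ideal S where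
  carrier := {g | ∃ n : ℕ, ∀ h ∈ (Ideal.span (Set.range (X : Fin 3 → S))) ^ n, h * g ∈ J}
  zero_mem' := ⟨0, fun h _ => by simp⟩
  add_mem' := by
    rintro a b ⟨m, hm⟩ ⟨n, hn⟩
    refine ⟨m + n, fun h hh => ?_⟩
    rw [mul_add]
    exact J.add_mem (hm h (Ideal.pow_le_pow_right (Nat.le_add_right m n) hh))
      (hn h (Ideal.pow_le_pow_right (Nat.le_add_left n m) hh))
  smul_mem' := by
    rintro c g ⟨n, hn⟩
    refine ⟨n, fun h hh => ?_⟩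
    rw [smul_eq_mul, mul_left_comm]
    exact J.mul_mem_left c (hn h hh)

/-- `dim (S_k / I_k)`, where `S_k` is the space of forms of degree `k` and `I_k = I ∩ S_k`. -/
noncomputable def dimQuotient (I : Ideal S) (k : ℕ) : ℕ :=
  Module.finrank ℂ
    (homogeneousSubmodule (Fin 3) ℂ k ⧸
      (I.restrictScalars ℂ).submoduleOf (homogeneousSubmodule (Fin 3) ℂ k))

/-- `dim M(f)_k`, where `M(f) = S / J_f` is the Jacobian (Milnor) algebra. -/
noncomputable def dimMilnor (f : S) (k : ℕ) : ℕ :=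
  dimQuotient (jacobianIdeal f) k

/-- The graded module of Jacobian syzygies
`D₀(f) = {(a, b, c) ∈ S³ : a f_x + b f_y + c f_z = 0}`. -/
noncomputable def syzygies (f : S) : Submodule S (Fin 3 → S) where
  carrier := {ρ | ∑ i, ρ i * pderiv i f = 0}
  zero_mem' := by simp
  add_mem' := by
    intro a b ha hb
    simp only [Set.mem_ofPred_eq, Pi.add_apply, add_mul, Finset.sum_add_distrib] at *
    rw [ha, hb, add_zero]
  smul_mem' := by
    intro c a ha
    simp only [Set.mem_ofPred_eq, Pi.smul_apply, smul_eq_mul, mul_assoc, ← Finset.mul_sum] at *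
    rw [ha, mul_zero]

/-- `ρ₁, …, ρ_m` is a minimal set of homogeneous generators of `D₀(f)`, with degrees
`e₁ ≤ … ≤ e_m`: that is, `f = 0` is an `m`-syzygy curve with exponents `(e₁, …, e_m)`. -/
structure IsMinimalGenerators (f : S) {m : ℕ} (ρ : Fin m → (Fin 3 → S)) (e : Fin m → ℕ) :
    Prop where
  homogeneous : ∀ j i, (ρ j i).IsHomogeneous (e j)
  span_eq : Submodule.span S (Set.range ρ) = syzygies f
  minimal : ∀ s : Set (Fin m), Submodule.span S (ρ '' s) = syzygies f → s = Set.univ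
  monotone : Monotone e

/-- The curve `f = 0` is free with exponents `(d₁, d₂)`: the module `D₀(f)` has a minimal set of
two homogeneous generators, of degrees `d₁ ≤ d₂`. -/
def IsFreeWithExponents (f : S) (d₁ d₂ : ℕ) : Prop :=
  ∃ ρ : Fin 2 → (Fin 3 → S), IsMinimalGenerators f ρ ![d₁, d₂]

/-- The equation of the curve in the affine chart of `ℙ²` where the `i`-th coordinate is `1`. -/
noncomputable def dehomogenize (f : S) (i : Fin 3) : MvPolynomial (Fin 2) ℂ :=
  aeval (i.insertNth (α := fun _ => MvPolynomial (Fin 2) ℂ) 1 X) f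

instance isPrime_ker_eval (a : Fin 2 → ℂ) : (RingHom.ker (eval (R := ℂ) a)).IsPrime :=
  RingHom.ker_isPrime _

/-- The local ring of the affine plane at the point `a`. -/
abbrev LocalRingAt (a : Fin 2 → ℂ) : Type :=
  Localization.AtPrime (RingHom.ker (eval (R := ℂ) a))

/-- The Tjurina number `dim 𝒪_a / (g, g_u, g_v)` at the point `a` of the affine curve `g = 0`. -/
noncomputable def affineTjurina (g : MvPolynomial (Fin 2) ℂ) (a : Fin 2 → ℂ) : ℕ :=
  Module.finrank ℂ (LocalRingAt a ⧸
    (Ideal.span {g, pderiv 0 g, pderiv 1 g}).map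
      (algebraMap (MvPolynomial (Fin 2) ℂ) (LocalRingAt a)))

/-- The index of a standard affine chart containing the point `p`. -/
noncomputable def chartIndex (p : ℙ ℂ (Fin 3 → ℂ)) : Fin 3 :=
  if p.rep 2 ≠ 0 then 2 else if p.rep 1 ≠ 0 then 1 else 0

theorem rep_chartIndex_ne_zero (p : ℙ ℂ (Fin 3 → ℂ)) : p.rep (chartIndex p) ≠ 0 := by
  unfold chartIndex
  split_ifs with h2 h1
  · exact h2
  · exact h1
  · intro h0
    refine p.rep_nonzero (funext fun i => ?_)
    push Not at h1 h2
    fin_cases i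
    · exact h0
    · exact h1
    · exact h2

/-- The Tjurina number at `p` of the curve `f = 0`, computed in an affine chart around `p`
(the number does not depend on the chart). -/
noncomputable def tjurinaAt (f : S) (p : ℙ ℂ (Fin 3 → ℂ)) : ℕ :=
  affineTjurina (dehomogenize f (chartIndex p))
    (fun j => p.rep ((chartIndex p).succAbove j) / p.rep (chartIndex p))

/-- The singular points of the curve `f = 0` in `ℙ²`. -/
def singularPoints (f : S) : Set (ℙ ℂ (Fin 3 → ℂ)) :=
  {p | eval p.rep f = 0 ∧ ∀ i, eval p.rep (pderiv i f) = 0}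

/-- The total Tjurina number `τ(C)`: the sum of the Tjurina numbers of the singularities of `C`
(a finite sum when `f` is squarefree). -/
noncomputable def totalTjurina (f : S) : ℕ :=
  ∑ᶠ p ∈ singularPoints f, tjurinaAt f p

/-- The defect `def_k Σ_f = τ(C) - dim (S_k / I_k)` of the singular subscheme `Σ_f`, which is
defined by the saturation `I = I_f` of the Jacobian ideal. -/
noncomputable def defect (f : S) (k : ℕ) : ℤ :=
  (totalTjurina f : ℤ) - dimQuotient (saturation (jacobianIdeal f)) k

end PlaneCurve

namespace PlaneCurve

open MvPolynomial
open scoped LinearAlgebra.Projectivization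

/-! ### Derivatives and prime factors of polynomials -/

section Prelim

variable {σ : Type*}

/-! Write m = d - 1. Two generators of D₀(f) have nonzero cross product, so they are independent
over S and 0 → S(-m-d₁) ⊕ S(-m-d₂) → S(-m)³ → S → M(f) → 0 is exact. Taking dimensions
(`dimMilnor_add`) expresses dim M(f)_k through binomial coefficients.

The cross product is orthogonal to both generators, hence parallel to the gradient of f. As f is
squarefree, the partial derivatives have no common prime factor, so the cross product is a multiple
of the gradient and d₁ + d₂ ≥ m (`le_add_of_generators`). Conversely, d₁ + d₂ > m would make dim
M(f)_k negative for large k (`add_le_of_hilbert`). Once d₁ + d₂ = m, the Hilbert function is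
constant from degree m + d₂ - 2 on (`hilbert_eq_const`) and strictly smaller one degree earlier
(`hilbert_lt`); that degree is k₁ = m + d₂ - 3 = 2d - 5 - d₁.

Two facts turn this into a statement about defects. A resolution this short leaves no socle, so J_f
is saturated and the defect is τ(C) - dim M(f)_k. And the constant value is τ(C): forms of large
degree map onto the product of the Tjurina algebras at the singular points, with kernel the
saturation of J_f, by the Nullstellensatz. All finiteness needed there comes from boundedness of the
Hilbert function. -/

theorem totalDegree_pderiv_lt {p : MvPolynomial σ ℂ} {i : σ} (h : pderiv i p ≠ 0) :
    (pderiv i p).totalDegree < p.totalDegree := by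
  have key : ∀ m ∈ (pderiv i p).support, m.degree + 1 ≤ p.totalDegree := by
    intro m hm
    have h1 : m + Finsupp.single i 1 ∈ p.support := by
      rw [mem_support_iff] at hm ⊢
      intro h0
      rw [coeff_pderiv, h0, zero_mul] at hm
      exact hm rfl
    have h2 := le_totalDegree h1
    change (m + Finsupp.single i 1).degree ≤ _ at h2
    rwa [map_add, Finsupp.degree_single] at h2
  obtain ⟨m, hm⟩ := support_nonempty.2 h
  have hpos : 0 < p.totalDegree := by have := key m hm; omega
  exact (Finset.sup_lt_iff (by simpa using hpos)).2 fun m hm => key m hm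

theorem eq_C_of_pderiv_eq_zero {p : MvPolynomial σ ℂ} (h : ∀ i, pderiv i p = 0) :
    p = C (coeff 0 p) := by
  classical
  ext m
  rw [coeff_C]
  split_ifs with hm
  · rw [← hm]
  · obtain ⟨i, hi⟩ : ∃ i, m i ≠ 0 := by
      by_contra! hc
      exact hm (Finsupp.ext fun i => (hc i).symm)
    have h1 := coeff_pderiv (i := i) p (m - Finsupp.single i 1)
    rw [h i, coeff_zero, tsub_add_cancel_of_le
      (Finsupp.single_le_iff.2 (Nat.one_le_iff_ne_zero.2 hi))] at h1
    rcases mul_eq_zero.1 h1.symm with h2 | h2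
    · exact h2
    · exact absurd h2 (Nat.cast_add_one_ne_zero _)

/-- In a factorial domain, if `a` divides all `b j * c`, and the `b j` have no common prime
factor, then `a` divides `c`. -/
theorem dvd_of_dvd_mul_of_no_common_prime {R ι : Type*} [CommRing R] [IsDomain R]
    [UniqueFactorizationMonoid R] {b : ι → R} (h0 : ∃ j, b j ≠ 0)
    (hb : ∀ p, Prime p → ∃ j, ¬ p ∣ b j) (a : R) :
    ∀ c, (∀ j, a ∣ b j * c) → a ∣ c := by
  induction a using UniqueFactorizationMonoid.induction_on_prime with
  | h₁ =>
    intro c hc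
    obtain ⟨j, hj⟩ := h0
    rcases mul_eq_zero.1 (zero_dvd_iff.1 (hc j)) with h | h
    · exact absurd h hj
    · rw [h]
  | h₂ x hx => exact fun c _ => hx.dvd
  | h₃ a p _ hp ih =>
    intro c hc
    obtain ⟨j, hj⟩ := hb p hp
    obtain ⟨c', rfl⟩ := ((hp.dvd_or_dvd ((dvd_mul_right p a).trans (hc j))).resolve_left hj)
    refine mul_dvd_mul_left p (ih c' fun j => ?_)
    have := hc j
    rw [mul_left_comm] at this
    exact (mul_dvd_mul_iff_left hp.ne_zero).1 this

end Prelim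

variable {f : S} {d : ℕ}

theorem dvd_of_dvd_pderiv (hd : d ≠ 0) (hf : f.IsHomogeneous d) {p : S}
    (h : ∀ i, p ∣ pderiv i f) : p ∣ f := by
  have h1 : p ∣ d • f := by
    rw [← hf.sum_X_mul_pderiv]
    exact Finset.dvd_sum fun i _ => (h i).mul_left _
  have h2 : f = C ((d : ℂ)⁻¹) * (d • f) := by
    have : (d : ℂ) ≠ 0 := Nat.cast_ne_zero.2 hd
    rw [nsmul_eq_mul, ← mul_assoc, ← map_natCast (C (σ := Fin 3) (R := ℂ)), ← C_mul,
      inv_mul_cancel₀ this, C_1, one_mul]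
  rw [h2]
  exact h1.mul_left _

/-- By Euler's formula a common prime p of the partials divides f = p * q. Squarefreeness gives p ∤
q, so p divides its own derivatives; these have smaller degree, hence vanish, and p would be
constant. -/
theorem exists_not_dvd_pderiv (hd : d ≠ 0) (hf : f.IsHomogeneous d) (hred : Squarefree f)
    (p : S) (hp : Prime p) : ∃ i, ¬ p ∣ pderiv i f := by
  by_contra! h
  obtain ⟨q, rfl⟩ := dvd_of_dvd_pderiv hd hf h
  have hpq : ¬ p ∣ q := fun hq => hp.not_isUnit (hred p (mul_dvd_mul_left p hq))
  have hz : ∀ i, pderiv i p = 0 := by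
    intro i
    have h1 := h i
    rw [pderiv_mul, (dvd_add_left (dvd_mul_right p _))] at h1
    obtain ⟨r, hr⟩ := (hp.dvd_or_dvd h1).resolve_right hpq
    by_contra hne
    have h2 := totalDegree_pderiv_lt hne
    have hr0 : r ≠ 0 := by rintro rfl; exact hne (by rw [hr, mul_zero])
    rw [hr, totalDegree_mul_of_isDomain hp.ne_zero hr0] at h2
    omega
  have hC := eq_C_of_pderiv_eq_zero hz
  apply hp.not_isUnit
  rw [hC]
  refine (isUnit_iff_ne_zero.2 fun h0 => hp.ne_zero ?_).map C
  rw [hC, h0, C_0]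

theorem exists_pderiv_ne_zero (hd : d ≠ 0) (hf : f.IsHomogeneous d) (hred : Squarefree f) :
    ∃ i, pderiv i f ≠ 0 := by
  by_contra! h
  obtain ⟨i, hi⟩ := exists_not_dvd_pderiv hd hf hred (X 0) (X_prime)
  exact hi (by rw [h i]; exact dvd_zero _)

theorem mem_syzygies {ρ : Fin 3 → S} : ρ ∈ syzygies f ↔ ∑ i, ρ i * pderiv i f = 0 := Iff.rfl

theorem mem_jacobianIdeal {g : S} :
    g ∈ jacobianIdeal f ↔ ∃ c : Fin 3 → S, ∑ i, c i * pderiv i f = g :=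
  Ideal.mem_span_range_iff_exists_fun

/-! ### Independence of the generators, and the lower bound for the sum of exponents -/

section Rank

open Matrix

theorem cross_smul_add (a b a' b' : S) (u v : Fin 3 → S) :
    (a • u + b • v) ⨯₃ (a' • u + b' • v) = (a * b' - b * a') • (u ⨯₃ v) := by
  rw [cross_apply, cross_apply]
  funext i
  fin_cases i <;> simp <;> ring

/-- Two generators of the module of syzygies have a nonzero cross product. -/
theorem cross_ne_zero {ρ : Fin 2 → Fin 3 → S} (hspan : Submodule.span S (Set.range ρ) = syzygies f)
    (h0 : ∃ i, pderiv i f ≠ 0) : ρ 0 ⨯₃ ρ 1 ≠ 0 := by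
  intro hc
  -- If the generators were parallel, all syzygies would be; but cross products of the Koszul
  -- syzygies below have the squares of the partials as entries.
  have key : ∀ u ∈ syzygies f, ∀ v ∈ syzygies f, u ⨯₃ v = 0 := by
    intro u hu v hv
    rw [← hspan, Submodule.mem_span_range_iff_exists_fun] at hu hv
    obtain ⟨a, rfl⟩ := hu
    obtain ⟨b, rfl⟩ := hv
    rw [Fin.sum_univ_two, Fin.sum_univ_two, cross_smul_add, hc, smul_zero]
  set F := fun i => pderiv i f with hF
  have k1 : (![F 1, -F 0, 0] : Fin 3 → S) ∈ syzygies f := by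
    rw [mem_syzygies]; simp [Fin.sum_univ_three, hF]; ring
  have k2 : (![F 2, 0, -F 0] : Fin 3 → S) ∈ syzygies f := by
    rw [mem_syzygies]; simp [Fin.sum_univ_three, hF]; ring
  have k3 : (![0, F 2, -F 1] : Fin 3 → S) ∈ syzygies f := by
    rw [mem_syzygies]; simp [Fin.sum_univ_three, hF]; ring
  have e0 := congrFun (key _ k1 _ k2) 0
  have e1 := congrFun (key _ k1 _ k3) 1
  have e2 := congrFun (key _ k2 _ k3) 2
  simp [cross_apply] at e0 e1 e2
  obtain ⟨i, hi⟩ := h0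
  fin_cases i
  · exact hi e0
  · exact hi e1
  · exact hi e2

theorem eq_zero_of_smul_add_smul_eq_zero {u v : Fin 3 → S} (h : u ⨯₃ v ≠ 0) {a b : S}
    (hab : a • u + b • v = 0) : a = 0 ∧ b = 0 := by
  have h1 := cross_smul_add a b 0 1 u v
  have h2 := cross_smul_add a b 1 0 u v
  rw [hab, LinearMap.map_zero₂] at h1 h2
  have h1' := (smul_eq_zero.1 h1.symm).resolve_right h
  have h2' := (smul_eq_zero.1 h2.symm).resolve_right h
  constructor
  · simpa using h1'
  · simpa using h2'

/-- Both vectors are orthogonal to the gradient, so their cross product is parallel to it. -/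
theorem cross_mul_pderiv {u v : Fin 3 → S} (hu : u ∈ syzygies f) (hv : v ∈ syzygies f)
    (i j : Fin 3) : pderiv i f * (u ⨯₃ v) j = pderiv j f * (u ⨯₃ v) i := by
  rw [mem_syzygies, Fin.sum_univ_three] at hu hv
  rw [cross_apply]
  fin_cases i <;> fin_cases j <;> simp
  · linear_combination u 2 * hv - v 2 * hu
  · linear_combination v 1 * hu - u 1 * hv
  · linear_combination v 2 * hu - u 2 * hv
  · linear_combination u 0 * hv - v 0 * hu
  · linear_combination u 1 * hv - v 1 * hu
  · linear_combination v 0 * hu - u 0 * hv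

theorem cross_isHomogeneous {u v : Fin 3 → S} {a b : ℕ} (hu : ∀ i, (u i).IsHomogeneous a)
    (hv : ∀ i, (v i).IsHomogeneous b) (i : Fin 3) : ((u ⨯₃ v) i).IsHomogeneous (a + b) := by
  rw [cross_apply]
  fin_cases i
  · exact ((hu 1).mul (hv 2)).sub ((hu 2).mul (hv 1))
  · exact ((hu 2).mul (hv 0)).sub ((hu 0).mul (hv 2))
  · exact ((hu 0).mul (hv 1)).sub ((hu 1).mul (hv 0))

theorem le_add_of_generators (hd : d ≠ 0) (hf : f.IsHomogeneous d) (hred : Squarefree f)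
    {ρ : Fin 2 → Fin 3 → S} {a b : ℕ} (hspan : Submodule.span S (Set.range ρ) = syzygies f)
    (ha : ∀ i, (ρ 0 i).IsHomogeneous a) (hb : ∀ i, (ρ 1 i).IsHomogeneous b) : d - 1 ≤ a + b := by
  have h0 := exists_pderiv_ne_zero hd hf hred
  have hc := cross_ne_zero hspan h0
  have hρ : ∀ j, ρ j ∈ syzygies f := fun j => hspan ▸ Submodule.subset_span ⟨j, rfl⟩
  obtain ⟨i, hi⟩ := h0
  have hci : (ρ 0 ⨯₃ ρ 1) i ≠ 0 := by
    intro h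
    refine hc (funext fun j => ?_)
    have := cross_mul_pderiv (hρ 0) (hρ 1) i j
    rw [h, mul_zero] at this
    exact (mul_eq_zero.1 this).resolve_left hi
  obtain ⟨r, hr⟩ := dvd_of_dvd_mul_of_no_common_prime ⟨i, hi⟩
    (exists_not_dvd_pderiv hd hf hred) (pderiv i f) ((ρ 0 ⨯₃ ρ 1) i)
    fun j => ⟨_, (cross_mul_pderiv (hρ 0) (hρ 1) i j).symm⟩
  have hr0 : r ≠ 0 := by rintro rfl; exact hci (by rw [hr, mul_zero])
  have h1 := (cross_isHomogeneous ha hb i).totalDegree hci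
  rw [hr, totalDegree_mul_of_isDomain hi hr0, hf.pderiv.totalDegree hi] at h1
  omega

end Rank

/-! ### The Jacobian ideal of a free curve is saturated -/

section Saturated

/-- Exactness of the Koszul complex on the variables: setting `X 0 = X 1 = 0` puts `u` in the ideal
`(X 1, X 0)`, and dividing by `X 0` gives the rest. -/
theorem exists_eq_of_koszul {u v w : S} (h : X 2 * u + X 0 * v + X 1 * w = 0) :
    ∃ p q r : S, u = X 1 * p - X 0 * q ∧ v = X 2 * q - X 1 * r ∧ w = X 0 * r - X 2 * p := by
  let s : S →ₐ[ℂ] S := aeval ![0, 0, X 2]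
  have hs : ∀ p : S, p - s p ∈ Ideal.span {(X 1 : S), X 0} := by
    intro p
    induction p using MvPolynomial.induction_on with
    | C a => simp [s]
    | add p q hp hq => rw [map_add, add_sub_add_comm]; exact add_mem hp hq
    | mul_X p i hp =>
      rw [map_mul]
      fin_cases i
      · simpa [s] using Ideal.mul_mem_left _ p (Ideal.subset_span (by simp))
      · simpa [s] using Ideal.mul_mem_left _ p (Ideal.subset_span (by simp))
      · simpa [s, sub_mul] using Ideal.mul_mem_right (X 2) _ hp
  have hu : s u = 0 := by
    have := congrArg s h
    simpa [s] using this
  obtain ⟨p, q, hpq⟩ := Ideal.mem_span_pair.1 (hs u)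
  rw [hu, sub_zero] at hpq
  have h1 : X 0 * (v - X 2 * -q) + X 1 * (w + X 2 * p) = 0 := by
    rw [← h, ← hpq]; ring
  have h2 : (X 0 : S) ∣ X 1 * (w + X 2 * p) := ⟨-(v - X 2 * -q), by linear_combination h1⟩
  obtain ⟨r, hr⟩ := (X_prime.dvd_or_dvd h2).resolve_left (by simp [X_dvd_X])
  refine ⟨p, -q, r, by rw [← hpq]; ring, ?_, by rw [← hr]; ring⟩
  rw [hr] at h1
  have h3 : (X 0 : S) * (v - X 2 * -q + X 1 * r) = 0 := by linear_combination h1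
  have h4 := (mul_eq_zero.1 h3).resolve_left (X_ne_zero 0)
  linear_combination h4

/-- An ideal with a free resolution of length two is saturated: the Jacobian ideal of a
free curve has no socle. -/
theorem mem_jacobianIdeal_of_X_mul_mem {ρ : Fin 2 → Fin 3 → S}
    (hspan : Submodule.span S (Set.range ρ) = syzygies f)
    (hind : ∀ a b : S, a • ρ 0 + b • ρ 1 = 0 → a = 0 ∧ b = 0) {g : S}
    (hg : ∀ i, X i * g ∈ jacobianIdeal f) : g ∈ jacobianIdeal f := by
  have hg' := fun i => mem_jacobianIdeal.1 (hg i)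
  choose A hA using hg'
  have hsyz : ∀ i j, ∃ c : Fin 2 → S,
      (X j : S) • A i - (X i : S) • A j = c 0 • ρ 0 + c 1 • ρ 1 := by
    intro i j
    have hm : (X j : S) • A i - (X i : S) • A j ∈ syzygies f := by
      rw [mem_syzygies]
      simp only [Pi.sub_apply, Pi.smul_apply, smul_eq_mul, sub_mul, mul_assoc,
        Finset.sum_sub_distrib, ← Finset.mul_sum, hA]
      ring
    rw [← hspan, Submodule.mem_span_range_iff_exists_fun] at hm
    obtain ⟨c, hc⟩ := hm
    exact ⟨c, by rw [← hc, Fin.sum_univ_two]⟩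
  obtain ⟨u, hu⟩ := hsyz 0 1
  obtain ⟨v, hv⟩ := hsyz 1 2
  obtain ⟨w, hw⟩ := hsyz 2 0
  -- The cyclic combination of the three syzygies vanishes identically, so by independence their
  -- coefficients satisfy a Koszul relation.
  have hrel := hind (X 2 * u 0 + X 0 * v 0 + X 1 * w 0) (X 2 * u 1 + X 0 * v 1 + X 1 * w 1) (by
    have : (X 2 * u 0 + X 0 * v 0 + X 1 * w 0) • ρ 0 + (X 2 * u 1 + X 0 * v 1 + X 1 * w 1) • ρ 1
        = (X 2 : S) • (u 0 • ρ 0 + u 1 • ρ 1) + (X 0 : S) • (v 0 • ρ 0 + v 1 • ρ 1)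
          + (X 1 : S) • (w 0 • ρ 0 + w 1 • ρ 1) := by module
    rw [this, ← hu, ← hv, ← hw]
    module)
  obtain ⟨p₀, q₀, r₀, hu₀, hv₀, hw₀⟩ := exists_eq_of_koszul hrel.1
  obtain ⟨p₁, q₁, r₁, hu₁, hv₁, hw₁⟩ := exists_eq_of_koszul hrel.2
  set P := p₀ • ρ 0 + p₁ • ρ 1 with hP
  set Q := q₀ • ρ 0 + q₁ • ρ 1 with hQ
  set R := r₀ • ρ 0 + r₁ • ρ 1 with hR
  -- Subtracting the syzygies `P` and `Q` makes `A 0` and `A 1` compatible, so `A 0 - P` is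
  -- divisible by `X 0`; the quotient `E` represents `g`.
  have e1 : (X 1 : S) • (A 0 - P) = (X 0 : S) • (A 1 - Q) := by
    rw [hu₀, hu₁] at hu
    have : (X 1 * p₀ - X 0 * q₀) • ρ 0 + (X 1 * p₁ - X 0 * q₁) • ρ 1
      = (X 1 : S) • P - (X 0 : S) • Q := by rw [hP, hQ]; module
    rw [this] at hu
    rw [smul_sub, smul_sub, sub_eq_sub_iff_sub_eq_sub]
    exact hu
  have hdiv : ∀ i, (X 0 : S) ∣ (A 0 - P) i := by
    intro i
    have h1 := congrFun e1 i
    simp only [Pi.smul_apply, smul_eq_mul] at h1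
    exact (X_prime.dvd_or_dvd ⟨_, h1⟩).resolve_left (by simp [X_dvd_X])
  choose E hE using hdiv
  have hPm : P ∈ syzygies f := by
    rw [← hspan]
    exact add_mem (Submodule.smul_mem _ _ (Submodule.subset_span ⟨0, rfl⟩))
      (Submodule.smul_mem _ _ (Submodule.subset_span ⟨1, rfl⟩))
  refine mem_jacobianIdeal.2 ⟨E, ?_⟩
  have h2 : (X 0 : S) * ∑ i, E i * pderiv i f = X 0 * g := by
    rw [← hA 0, Finset.mul_sum]
    simp only [← mul_assoc, ← hE, Pi.sub_apply, sub_mul, Finset.sum_sub_distrib]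
    rw [mem_syzygies.1 hPm, sub_zero]
  exact mul_left_cancel₀ (X_ne_zero 0) h2

theorem saturation_eq_self {J : Ideal S} (h : ∀ g, (∀ i, X i * g ∈ J) → g ∈ J) :
    saturation J = J := by
  refine le_antisymm ?_ fun g hg => ⟨0, fun h _ => J.mul_mem_left h hg⟩
  rintro g ⟨n, hn⟩
  induction n with
  | zero => simpa using hn 1 (by simp)
  | succ n ih =>
    refine ih fun a ha => h _ fun i => ?_
    rw [← mul_assoc]
    refine hn _ ?_
    rw [pow_succ']
    exact Ideal.mul_mem_mul (Ideal.subset_span ⟨i, rfl⟩) ha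

end Saturated

/-! ### The Hilbert function of the Milnor algebra -/

theorem finrank_homogeneousSubmodule (n : ℕ) :
    Module.finrank ℂ (homogeneousSubmodule (Fin 3) ℂ n) = (n + 2).choose 2 := by
  have hset : {d : Fin 3 →₀ ℕ | d.degree = n} =
      ↑(Finset.univ.finsuppAntidiag n : Finset (Fin 3 →₀ ℕ)) := by
    ext d
    simp [Finset.mem_finsuppAntidiag, Finsupp.degree_eq_sum]
  rw [homogeneousSubmodule_eq_finsupp_supported, hset,
    (AddMonoidAlgebra.supportedEquivFinsupp (R := ℂ) _).finrank_eq, Module.finrank_finsupp_self,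
    ← Nat.card_eq_fintype_card, Nat.card_coe_set_eq, Set.ncard_coe_finset,
    Finset.card_finsuppAntidiag_nat_eq_choose, Finset.card_univ, Fintype.card_fin,
    show 3 + n - 1 = n + 2 by omega]
  exact Nat.choose_symm_of_eq_add rfl

instance finite_homogeneousSubmodule (n : ℕ) :
    Module.Finite ℂ (homogeneousSubmodule (Fin 3) ℂ n) :=
  Module.Finite.iff_fg.2 (homogeneousSubmodule_fg _ _ n)

/-- The space of forms of degree `k - a`, which is zero for `k < a`. -/
noncomputable def formsOfShift (k a : ℕ) : Submodule ℂ S :=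
  if a ≤ k then homogeneousSubmodule (Fin 3) ℂ (k - a) else ⊥

/-- The component of degree `k - a` of a polynomial, which is zero for `k < a`. -/
noncomputable def componentOfShift (k a : ℕ) : S →ₗ[ℂ] S :=
  if a ≤ k then homogeneousComponent (k - a) else 0

theorem formsOfShift_of_le {k a : ℕ} (h : a ≤ k) :
    formsOfShift k a = homogeneousSubmodule (Fin 3) ℂ (k - a) := if_pos h

theorem formsOfShift_of_lt {k a : ℕ} (h : k < a) : formsOfShift k a = ⊥ := if_neg (not_le.2 h)

theorem formsOfShift_zero (k : ℕ) : formsOfShift k 0 = homogeneousSubmodule (Fin 3) ℂ k :=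
  formsOfShift_of_le (Nat.zero_le k)

instance finite_formsOfShift (k a : ℕ) : Module.Finite ℂ (formsOfShift k a) := by
  rcases le_or_gt a k with h | h
  · rw [formsOfShift_of_le h]; infer_instance
  · rw [formsOfShift_of_lt h]; infer_instance

/-- Truncated subtraction is harmless: for `k < a` it leaves at most 1 above the 2, so the binomial
is 0 as it should be. -/
theorem finrank_formsOfShift (k a : ℕ) :
    Module.finrank ℂ (formsOfShift k a) = (k + 2 - a).choose 2 := by
  rcases le_or_gt a k with h | h
  · rw [formsOfShift_of_le h, finrank_homogeneousSubmodule, show k + 2 - a = k - a + 2 by omega]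
  · rw [formsOfShift_of_lt h, finrank_bot, Nat.choose_eq_zero_of_lt (by omega)]

theorem componentOfShift_mem (k a : ℕ) (p : S) : componentOfShift k a p ∈ formsOfShift k a := by
  unfold componentOfShift formsOfShift
  split_ifs
  · exact homogeneousComponent_mem _ _
  · exact zero_mem _

theorem componentOfShift_eq_self {k a : ℕ} {p : S} (hp : p ∈ formsOfShift k a) :
    componentOfShift k a p = p := by
  unfold componentOfShift
  unfold formsOfShift at hp
  split_ifs at hp ⊢
  · exact homogeneousComponent_eq_self hp
  · exact ((Submodule.mem_bot ℂ).1 hp).symm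

theorem mul_mem_formsOfShift {k a e : ℕ} {p q : S} (hp : p ∈ formsOfShift k (a + e))
    (hq : q.IsHomogeneous e) : p * q ∈ formsOfShift k a := by
  rcases le_or_gt (a + e) k with h | h
  · rw [formsOfShift_of_le h] at hp
    rw [formsOfShift_of_le (by omega)]
    have := IsHomogeneous.mul hp hq
    rwa [show k - (a + e) + e = k - a by omega] at this
  · rw [formsOfShift_of_lt h, Submodule.mem_bot] at hp
    rw [hp, zero_mul]
    exact zero_mem _

theorem homogeneousComponent_mul_of_isHomogeneous {n e : ℕ} {p q : S} (hq : q.IsHomogeneous e) :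
    homogeneousComponent n (p * q) = if e ≤ n then homogeneousComponent (n - e) p * q else 0 := by
  conv_lhs => rw [← sum_homogeneousComponent p, Finset.sum_mul, map_sum]
  have h1 : ∀ i, homogeneousComponent n (homogeneousComponent i p * q) =
      if n = i + e then homogeneousComponent i p * q else 0 := fun i =>
    homogeneousComponent_of_mem ((homogeneousComponent_isHomogeneous i p).mul hq)
  simp only [h1]
  split_ifs with h
  · have h2 : ∀ i, n = i + e ↔ n - e = i := fun i => by omega
    simp only [h2, Finset.sum_ite_eq, Finset.mem_range]
    split_ifs with h3
    · rfl
    · rw [homogeneousComponent_eq_zero _ _ (by omega), zero_mul]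
  · exact Finset.sum_eq_zero fun i _ => if_neg (by omega)

theorem componentOfShift_mul {k a e : ℕ} {p q : S} (hq : q.IsHomogeneous e) :
    componentOfShift k a (p * q) = componentOfShift k (a + e) p * q := by
  unfold componentOfShift
  split_ifs with h1 h2 h2
  · rw [homogeneousComponent_mul_of_isHomogeneous hq, if_pos (by omega), Nat.sub_sub]
  · rw [homogeneousComponent_mul_of_isHomogeneous hq, if_neg (by omega), LinearMap.zero_apply,
      zero_mul]
  · omega
  · simp

section HilbertFunction

/-- `(p_j) ↦ ∑ p_j q_j`, from tuples of forms to forms, where the `q_j` are forms. -/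
noncomputable def sumMulForms {ι : Type*} [Fintype ι] (k a : ℕ) {e : ι → ℕ} (q : ι → S)
    (hq : ∀ j, (q j).IsHomogeneous (e j)) :
    ((j : ι) → formsOfShift k (a + e j)) →ₗ[ℂ] formsOfShift k a :=
  LinearMap.codRestrict _
    (∑ j, (LinearMap.mulRight ℂ (q j)).comp ((Submodule.subtype _).comp (LinearMap.proj j)))
    fun p => by
      rw [LinearMap.sum_apply]
      exact sum_mem fun j _ => mul_mem_formsOfShift (p j).2 (hq j)

theorem coe_sumMulForms {ι : Type*} [Fintype ι] (k a : ℕ) {e : ι → ℕ} (q : ι → S)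
    (hq : ∀ j, (q j).IsHomogeneous (e j)) (p : (j : ι) → formsOfShift k (a + e j)) :
    (sumMulForms k a q hq p : S) = ∑ j, (p j : S) * q j := by
  simp [sumMulForms]

theorem finrank_quotient_add (I : Ideal S) (k : ℕ) :
    dimQuotient I k + Module.finrank ℂ
      ((I.restrictScalars ℂ).submoduleOf (homogeneousSubmodule (Fin 3) ℂ k)) =
    (k + 2).choose 2 := by
  rw [dimQuotient, Submodule.finrank_quotient_add_finrank, finrank_homogeneousSubmodule]

/-- The coefficients expressing a form of degree `k` in the partials may be replaced by their
components of degree `k - (d - 1)`. -/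
theorem finrank_jacobianIdeal (hf : f.IsHomogeneous d) (k : ℕ) :
    Module.finrank ℂ (((jacobianIdeal f).restrictScalars ℂ).submoduleOf
      (homogeneousSubmodule (Fin 3) ℂ k)) =
    Module.finrank ℂ (LinearMap.range
      (sumMulForms k 0 (e := fun _ : Fin 3 => d - 1) (fun i => pderiv i f)
        fun _ => hf.pderiv)) := by
  rw [Submodule.submoduleOf, ← Submodule.finrank_map_subtype_eq,
    ← Submodule.finrank_map_subtype_eq (formsOfShift k 0)]
  refine congrArg (fun W : Submodule ℂ S => Module.finrank ℂ W) ?_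
  ext g
  simp only [Submodule.mem_map, Submodule.mem_comap, Submodule.subtype_apply,
    Submodule.restrictScalars_mem, Subtype.exists, exists_and_right, exists_eq_right,
    LinearMap.mem_range, mem_jacobianIdeal]
  constructor
  · rintro ⟨hg, c, hc⟩
    refine ⟨by rwa [formsOfShift_zero], fun i => ⟨_, componentOfShift_mem k _ (c i)⟩,
      Subtype.ext ?_⟩
    rw [coe_sumMulForms]
    simp only [← componentOfShift_mul (hf.pderiv)]
    rw [← map_sum, hc]
    exact componentOfShift_eq_self (by rwa [formsOfShift_zero])
  · rintro ⟨hg, c, hc⟩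
    refine ⟨by rwa [formsOfShift_zero] at hg, fun i => c i, ?_⟩
    exact (coe_sumMulForms _ _ _ _ c).symm.trans (congrArg Subtype.val hc)

/-- The map from pairs of forms to homogeneous syzygies given by two homogeneous syzygies. -/
noncomputable def syzygyMap (k : ℕ) (m : ℕ) {ρ : Fin 2 → Fin 3 → S} {e : Fin 2 → ℕ}
    (hρ : ∀ j i, (ρ j i).IsHomogeneous (e j)) :
    ((j : Fin 2) → formsOfShift k (0 + m + e j)) →ₗ[ℂ] (Fin 3 → formsOfShift k (0 + m)) :=
  LinearMap.pi fun i => sumMulForms k (0 + m) (fun j => ρ j i) fun j => hρ j i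

theorem coe_syzygyMap (k m : ℕ) {ρ : Fin 2 → Fin 3 → S} {e : Fin 2 → ℕ}
    (hρ : ∀ j i, (ρ j i).IsHomogeneous (e j)) (p : (j : Fin 2) → formsOfShift k (0 + m + e j)) :
    (fun i => (syzygyMap k m hρ p i : S)) = (p 0 : S) • ρ 0 + (p 1 : S) • ρ 1 := by
  funext i
  rw [syzygyMap, LinearMap.pi_apply, coe_sumMulForms, Fin.sum_univ_two]
  rfl

theorem ker_eq_range_syzygyMap (hf : f.IsHomogeneous d) (k : ℕ) {ρ : Fin 2 → Fin 3 → S}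
    {e : Fin 2 → ℕ} (hspan : Submodule.span S (Set.range ρ) = syzygies f)
    (hρ : ∀ j i, (ρ j i).IsHomogeneous (e j)) :
    LinearMap.ker (sumMulForms k 0 (e := fun _ : Fin 3 => d - 1) (fun i => pderiv i f)
      fun _ => hf.pderiv) = LinearMap.range (syzygyMap k (d - 1) hρ) := by
  ext c
  rw [LinearMap.mem_ker, LinearMap.mem_range, ← Submodule.coe_eq_zero, coe_sumMulForms,
    ← mem_syzygies (ρ := fun i => (c i : S)), ← hspan, Submodule.mem_span_range_iff_exists_fun]
  constructor
  · rintro ⟨b, hb⟩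
    refine ⟨fun j => ⟨_, componentOfShift_mem k _ (b j)⟩, funext fun i => Subtype.ext ?_⟩
    have h1 := congrFun (coe_syzygyMap k (d - 1) hρ
      fun j => ⟨_, componentOfShift_mem k _ (b j)⟩) i
    refine h1.trans ?_
    have h2 := congrFun hb i
    rw [Fin.sum_univ_two] at h2
    simp only [Pi.add_apply, Pi.smul_apply, smul_eq_mul] at h2 ⊢
    rw [← componentOfShift_mul (hρ 0 i), ← componentOfShift_mul (hρ 1 i), ← map_add, h2]
    exact componentOfShift_eq_self (c i).2
  · rintro ⟨p, rfl⟩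
    exact ⟨fun j => p j, by rw [Fin.sum_univ_two, coe_syzygyMap]⟩

theorem syzygyMap_injective (k m : ℕ) {ρ : Fin 2 → Fin 3 → S} {e : Fin 2 → ℕ}
    (hρ : ∀ j i, (ρ j i).IsHomogeneous (e j))
    (hind : ∀ a b : S, a • ρ 0 + b • ρ 1 = 0 → a = 0 ∧ b = 0) :
    Function.Injective (syzygyMap k m hρ) := by
  rw [injective_iff_map_eq_zero]
  intro p hp
  have h1 := coe_syzygyMap k m hρ p
  rw [hp] at h1
  obtain ⟨h2, h3⟩ := hind _ _ h1.symm
  funext j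
  fin_cases j
  · exact Subtype.ext h2
  · exact Subtype.ext h3

/-- The Hilbert function of the Milnor algebra of a free curve. -/
theorem dimMilnor_add (hf : f.IsHomogeneous d) (k : ℕ) {ρ : Fin 2 → Fin 3 → S}
    {e : Fin 2 → ℕ} (hspan : Submodule.span S (Set.range ρ) = syzygies f)
    (hρ : ∀ j i, (ρ j i).IsHomogeneous (e j))
    (hind : ∀ a b : S, a • ρ 0 + b • ρ 1 = 0 → a = 0 ∧ b = 0) :
    dimMilnor f k + 3 * (k + 2 - (d - 1)).choose 2 = (k + 2).choose 2 +
      (k + 2 - (d - 1 + e 0)).choose 2 + (k + 2 - (d - 1 + e 1)).choose 2 := by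
  have h1 := finrank_quotient_add (jacobianIdeal f) k
  rw [finrank_jacobianIdeal hf k] at h1
  have h2 := LinearMap.finrank_range_add_finrank_ker (sumMulForms k 0
    (e := fun _ : Fin 3 => d - 1) (fun i => pderiv i f) fun _ => hf.pderiv)
  rw [ker_eq_range_syzygyMap hf k hspan hρ,
    LinearMap.finrank_range_of_inj (syzygyMap_injective k _ hρ hind),
    Module.finrank_pi_fintype, Module.finrank_pi_fintype, Fin.sum_univ_two,
    Fin.sum_univ_three] at h2
  simp only [finrank_formsOfShift, zero_add] at h2
  rw [dimMilnor]
  omega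

end HilbertFunction

/-! ### Consequences of the binomial formula -/

section Numerics

theorem two_mul_choose_two (n : ℕ) : (2 : ℤ) * (n.choose 2 : ℕ) = n * (n - 1) := by
  rcases n with _ | n
  · simp
  · have h : 2 * (n + 1).choose 2 = (n + 1) * n := by
      rw [Nat.choose_two_right]
      exact Nat.mul_div_cancel' (Nat.even_mul_pred_self (n + 1)).two_dvd
    zify at h
    rw [h]
    push_cast
    ring

/-- If a Hilbert function is given by a free resolution of length two, then the exponents satisfy
`a + b ≤ m`. -/
theorem add_le_of_hilbert {M : ℕ → ℕ} {m a b : ℕ}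
    (h : ∀ k, M k + 3 * (k + 2 - m).choose 2 = (k + 2).choose 2 +
      (k + 2 - (m + a)).choose 2 + (k + 2 - (m + b)).choose 2) : a + b ≤ m := by
  by_contra! hc
  -- The quadratic terms in `n` cancel and the linear one has coefficient of the sign of `m - a -
  -- b`; a square of the parameters outgrows the constant term.
  set n := (m + a + m + b + 2) ^ 2 with hn
  have hn' : m + a + m + b ≤ n := by nlinarith
  have h1 := h n
  have e0 := two_mul_choose_two (n + 2)
  have e1 := two_mul_choose_two (n + 2 - m)
  have e2 := two_mul_choose_two (n + 2 - (m + a))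
  have e3 := two_mul_choose_two (n + 2 - (m + b))
  rw [Nat.cast_sub (by omega)] at e1 e2 e3
  push_cast at e0 e1 e2 e3
  zify at h1 hc hn
  have h4 : (0 : ℤ) ≤ M n := by positivity
  have h5 : (n : ℤ) * (a + b - m - 1) ≥ 0 := mul_nonneg (by positivity) (by linarith)
  nlinarith

theorem hilbert_eq_const {M : ℕ → ℕ} {m a b k l : ℕ}
    (h : ∀ k, M k + 3 * (k + 2 - m).choose 2 = (k + 2).choose 2 +
      (k + 2 - (m + a)).choose 2 + (k + 2 - (m + b)).choose 2) (hm : a + b = m) (hab : a ≤ b)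
    (hk : m + b ≤ k + 2) (hl : m + b ≤ l + 2) : M k = M l := by
  -- In this range no subtraction truncates, so every binomial is a quadratic polynomial; `a + b =
  -- m` then cancels all dependence on `n`.
  have key : ∀ n, m + b ≤ n + 2 → (2 : ℤ) * M n = 2 * (a * a + a * b + b * b) := by
    intro n hn
    have h1 := h n
    have e0 := two_mul_choose_two (n + 2)
    have e1 := two_mul_choose_two (n + 2 - m)
    have e2 := two_mul_choose_two (n + 2 - (m + a))
    have e3 := two_mul_choose_two (n + 2 - (m + b))
    rw [Nat.cast_sub (by omega)] at e1 e2 e3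
    subst hm
    push_cast at e0 e1 e2 e3
    zify at h1
    linarith
  have := key k hk
  rw [← key l hl] at this
  exact_mod_cast mul_left_cancel₀ two_ne_zero this

theorem hilbert_lt {M : ℕ → ℕ} {m a b k : ℕ}
    (h : ∀ k, M k + 3 * (k + 2 - m).choose 2 = (k + 2).choose 2 +
      (k + 2 - (m + a)).choose 2 + (k + 2 - (m + b)).choose 2) (hm : a + b = m) (hab : a ≤ b)
    (hb : 0 < b) (hk : m + b = k + 3) : M k < M (k + 1) := by
  subst hm
  have h0 := h k
  have h1 := h (k + 1)
  have c : ∀ n : ℕ, (n + 1).choose 2 = n + n.choose 2 := fun n => by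
    rw [Nat.choose_succ_succ' n 1, Nat.choose_one_right]
  have d0 := c (k + 2)
  have d1 := c (k + 2 - (a + b))
  rw [show k + 2 - (a + b) + 1 = k + 1 + 2 - (a + b) by omega] at d1
  rw [show k + 2 + 1 = k + 1 + 2 by omega] at d0
  have d3 : (k + 1 + 2 - (a + b + b)).choose 2 = 0 := Nat.choose_eq_zero_of_lt (by omega)
  have d4 : (k + 2 - (a + b + b)).choose 2 = 0 := Nat.choose_eq_zero_of_lt (by omega)
  -- The increment is 1 if `a < b`, and 2 if `a = b`, where the term of `a` vanishes in both degrees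
  -- by truncation.
  rcases hab.lt_or_eq with hlt | heq
  · have d2 := c (k + 2 - (a + b + a))
    rw [show k + 2 - (a + b + a) + 1 = k + 1 + 2 - (a + b + a) by omega] at d2
    omega
  · subst heq
    omega

end Numerics

/-! ### Passage to affine charts -/

section Dehomogenize

theorem eval_smul_of_isHomogeneous {σ : Type*} [Fintype σ] {p : MvPolynomial σ ℂ} {n : ℕ}
    (hp : p.IsHomogeneous n) (c : ℂ) (x : σ → ℂ) : eval (c • x) p = c ^ n * eval x p := by
  rw [eval_eq', eval_eq', Finset.mul_sum]
  refine Finset.sum_congr rfl fun m hm => ?_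
  have h1 : ∑ i, m i = n := by
    rw [← Finsupp.degree_eq_sum, Finsupp.degree_eq_weight_one]
    exact hp (mem_support_iff.1 hm)
  simp only [Pi.smul_apply, smul_eq_mul, mul_pow, Finset.prod_mul_distrib,
    Finset.prod_pow_eq_pow_sum, h1]
  ring

/-- Dehomogenization in the `i`-th chart, as a homomorphism of algebras. -/
noncomputable def dehom (i : Fin 3) : S →ₐ[ℂ] MvPolynomial (Fin 2) ℂ :=
  aeval (i.insertNth (α := fun _ => MvPolynomial (Fin 2) ℂ) 1 X)

@[simp]
theorem dehom_X_self (i : Fin 3) : dehom i (X i) = 1 := by simp [dehom]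

@[simp]
theorem dehom_X_succAbove (i : Fin 3) (j : Fin 2) : dehom i (X (i.succAbove j)) = X j := by
  simp [dehom]

theorem dehom_rename (i : Fin 3) (s : MvPolynomial (Fin 2) ℂ) :
    dehom i (rename i.succAbove s) = s := by
  induction s using MvPolynomial.induction_on with
  | C a => simp [dehom]
  | add p q hp hq => simp [hp, hq]
  | mul_X p j hp => simp [hp]

/-- The affine coordinates of a point in the `i`-th chart. -/
noncomputable def affinePoint (i : Fin 3) (x : Fin 3 → ℂ) : Fin 2 → ℂ :=
  fun j => x (i.succAbove j) / x i

theorem eval_dehom {i : Fin 3} {x : Fin 3 → ℂ} (hx : x i ≠ 0) {F : S} {n : ℕ}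
    (hF : F.IsHomogeneous n) : x i ^ n * eval (affinePoint i x) (dehom i F) = eval x F := by
  have h1 : eval (affinePoint i x) (dehom i F) = eval ((x i)⁻¹ • x) F := by
    clear hF
    induction F using MvPolynomial.induction_on with
    | C a => simp [dehom]
    | add p q hp hq => simp only [map_add, hp, hq]
    | mul_X p k hp =>
      rw [map_mul, map_mul, map_mul, hp, eval_X, Pi.smul_apply, smul_eq_mul, mul_comm (x i)⁻¹,
        ← div_eq_mul_inv]
      congr 1
      rcases Fin.eq_self_or_eq_succAbove i k with rfl | ⟨l, rfl⟩
      · rw [dehom_X_self, map_one, div_self hx]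
      · rw [dehom_X_succAbove, eval_X, affinePoint]
  rw [h1, eval_smul_of_isHomogeneous hF, ← mul_assoc, ← mul_pow, mul_inv_cancel₀ hx, one_pow,
    one_mul]

theorem eq_zero_of_dehom_eq_zero {i : Fin 3} {F : S} {n : ℕ} (hF : F.IsHomogeneous n)
    (h : dehom i F = 0) : F = 0 := by
  -- The factor `X i` disposes of the points with `x i = 0`, which the chart misses.
  have h1 : X i * F = 0 := by
    refine funext fun x => ?_
    rw [map_mul, eval_X, map_zero]
    by_cases hx : x i = 0
    · rw [hx, zero_mul]
    · rw [← eval_dehom hx hF, h, map_zero, mul_zero, mul_zero]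
  exact (mul_eq_zero.1 h1).resolve_left (X_ne_zero i)

theorem exists_form_dehom_eq (i : Fin 3) (s : MvPolynomial (Fin 2) ℂ) :
    ∃ N, ∀ n, N ≤ n → ∃ F : S, F.IsHomogeneous n ∧ dehom i F = s := by
  induction s using MvPolynomial.induction_on with
  | C a =>
    refine ⟨0, fun n _ => ⟨C a * X i ^ n, ?_, by simp [dehom]⟩⟩
    simpa using (isHomogeneous_C (Fin 3) a).mul (isHomogeneous_X_pow (R := ℂ) i n)
  | add p q hp hq =>
    obtain ⟨N, hN⟩ := hp
    obtain ⟨M, hM⟩ := hq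
    refine ⟨max N M, fun n hn => ?_⟩
    obtain ⟨F, hF, rfl⟩ := hN n (le_of_max_le_left hn)
    obtain ⟨G, hG, rfl⟩ := hM n (le_of_max_le_right hn)
    exact ⟨F + G, hF.add hG, map_add _ _ _⟩
  | mul_X p j hp =>
    obtain ⟨N, hN⟩ := hp
    refine ⟨N + 1, fun n hn => ?_⟩
    obtain ⟨F, hF, rfl⟩ := hN (n - 1) (by omega)
    refine ⟨F * X (i.succAbove j), ?_, by simp⟩
    have := hF.mul (isHomogeneous_X ℂ (i.succAbove j))
    rwa [Nat.sub_add_cancel (by omega)] at this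

theorem pderiv_dehom (i : Fin 3) (j : Fin 2) (F : S) :
    pderiv j (dehom i F) = dehom i (pderiv (i.succAbove j) F) := by
  induction F using MvPolynomial.induction_on with
  | C a => simp [dehom]
  | add p q hp hq => simp [hp, hq]
  | mul_X p k hp =>
    rw [map_mul, pderiv_mul, pderiv_mul, map_add, map_mul, map_mul, hp]
    congr 2
    rcases Fin.eq_self_or_eq_succAbove i k with rfl | ⟨l, rfl⟩
    · rw [dehom_X_self, pderiv_one, pderiv_X_of_ne (Fin.succAbove_ne k j).symm, map_zero]
    · rw [dehom_X_succAbove]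
      by_cases hl : l = j
      · rw [hl, pderiv_X_self, pderiv_X_self, map_one]
      · rw [pderiv_X_of_ne hl, pderiv_X_of_ne (fun h => hl (Fin.succAbove_right_injective h)),
          map_zero]

/-- The affine Jacobian ideal `(g, g_u, g_v)`. -/
noncomputable abbrev tjurinaIdeal (g : MvPolynomial (Fin 2) ℂ) : Ideal (MvPolynomial (Fin 2) ℂ) :=
  Ideal.span {g, pderiv 0 g, pderiv 1 g}

/-- Where the `i`-th variable is 1, Euler's formula trades the partial derivative in that variable
for `f` itself. -/
theorem tjurinaIdeal_dehom {f : S} {d : ℕ} (hd : d ≠ 0) (hf : f.IsHomogeneous d) (i : Fin 3) :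
    tjurinaIdeal (dehom i f) = (jacobianIdeal f).map (dehom i) := by
  have euler : dehom i (pderiv i f) +
      ∑ j : Fin 2, X j * pderiv j (dehom i f) = C (d : ℂ) * dehom i f := by
    have h := congrArg (dehom i) hf.sum_X_mul_pderiv
    rw [Fin.sum_univ_succAbove _ i, map_add, map_sum, map_mul, dehom_X_self, one_mul] at h
    simp only [map_mul, dehom_X_succAbove, ← pderiv_dehom] at h
    rw [h, nsmul_eq_mul, map_mul, map_natCast, map_natCast]
  have hmem : ∀ k, dehom i (pderiv k f) ∈ (jacobianIdeal f).map (dehom i) := fun k =>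
    Ideal.mem_map_of_mem _ (Ideal.subset_span ⟨k, rfl⟩)
  have hd' : (d : ℂ) ≠ 0 := Nat.cast_ne_zero.2 hd
  apply le_antisymm
  · have hp : ∀ j, pderiv j (dehom i f) ∈ (jacobianIdeal f).map (dehom i) := fun j => by
      rw [pderiv_dehom]; exact hmem _
    refine Ideal.span_le.2 ?_
    rintro g (rfl | rfl | rfl)
    · have h1 : dehom i f = C (d : ℂ)⁻¹ * (C (d : ℂ) * dehom i f) := by
        rw [← mul_assoc, ← C_mul, inv_mul_cancel₀ hd', C_1, one_mul]
      rw [h1, ← euler]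
      exact Ideal.mul_mem_left _ _ (add_mem (hmem i) (sum_mem fun j _ =>
        Ideal.mul_mem_left _ _ (hp j)))
    · exact hp 0
    · exact hp 1
  · rw [jacobianIdeal, Ideal.map_span, Ideal.span_le]
    rintro _ ⟨_, ⟨k, rfl⟩, rfl⟩
    have h0 : dehom i f ∈ tjurinaIdeal (dehom i f) := Ideal.subset_span (by simp)
    have hp : ∀ j, pderiv j (dehom i f) ∈ tjurinaIdeal (dehom i f) := by
      intro j
      fin_cases j <;> exact Ideal.subset_span (by simp)
    rcases Fin.eq_self_or_eq_succAbove i k with rfl | ⟨l, rfl⟩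
    · change dehom k (pderiv k f) ∈ _
      rw [eq_sub_of_add_eq euler]
      exact sub_mem (Ideal.mul_mem_left _ _ h0) (sum_mem fun j _ =>
        Ideal.mul_mem_left _ _ (hp j))
    · change dehom i (pderiv (i.succAbove l) f) ∈ _
      rw [← pderiv_dehom]
      exact hp l

end Dehomogenize

/-! ### Local Tjurina algebras -/

section LocalAlgebra

/-- The Tjurina algebra of the affine curve `g = 0` at the point `a`. -/
def TjurinaAlgebra (g : MvPolynomial (Fin 2) ℂ) (a : Fin 2 → ℂ) : Type :=
  LocalRingAt a ⧸ (tjurinaIdeal g).map (algebraMap (MvPolynomial (Fin 2) ℂ) (LocalRingAt a))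

variable (g : MvPolynomial (Fin 2) ℂ) (a : Fin 2 → ℂ)

noncomputable instance : CommRing (TjurinaAlgebra g a) :=
  inferInstanceAs (CommRing (LocalRingAt a ⧸
    (tjurinaIdeal g).map (algebraMap (MvPolynomial (Fin 2) ℂ) (LocalRingAt a))))

noncomputable instance : Algebra ℂ (TjurinaAlgebra g a) :=
  inferInstanceAs (Algebra ℂ (LocalRingAt a ⧸
    (tjurinaIdeal g).map (algebraMap (MvPolynomial (Fin 2) ℂ) (LocalRingAt a))))

/-- The projection from the local ring to the Tjurina algebra. -/
noncomputable def TjurinaAlgebra.mk : LocalRingAt a →ₐ[ℂ] TjurinaAlgebra g a :=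
  Ideal.Quotient.mkₐ ℂ
    ((tjurinaIdeal g).map (algebraMap (MvPolynomial (Fin 2) ℂ) (LocalRingAt a)))

theorem TjurinaAlgebra.mk_surjective : Function.Surjective (TjurinaAlgebra.mk g a) :=
  Ideal.Quotient.mk_surjective

theorem TjurinaAlgebra.mk_eq_zero_iff (β : LocalRingAt a) : TjurinaAlgebra.mk g a β = 0 ↔
    β ∈ (tjurinaIdeal g).map (algebraMap (MvPolynomial (Fin 2) ℂ) (LocalRingAt a)) :=
  Ideal.Quotient.eq_zero_iff_mem

/-- The map from polynomials to the Tjurina algebra at a point. -/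
noncomputable def toTjurina : MvPolynomial (Fin 2) ℂ →ₐ[ℂ] TjurinaAlgebra g a :=
  (TjurinaAlgebra.mk g a).comp (IsScalarTower.toAlgHom ℂ (MvPolynomial (Fin 2) ℂ) (LocalRingAt a))

theorem toTjurina_apply (r : MvPolynomial (Fin 2) ℂ) :
    toTjurina g a r = TjurinaAlgebra.mk g a (algebraMap _ (LocalRingAt a) r) := rfl

variable {g a}

theorem isUnit_toTjurina {s : MvPolynomial (Fin 2) ℂ} (hs : eval a s ≠ 0) :
    IsUnit (toTjurina g a s) := by
  rw [toTjurina_apply]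
  exact ((IsLocalization.AtPrime.isUnit_to_map_iff (LocalRingAt a)
    (RingHom.ker (eval a)) s).2 hs).map (TjurinaAlgebra.mk g a)

theorem toTjurina_eq_zero_iff {r : MvPolynomial (Fin 2) ℂ} :
    toTjurina g a r = 0 ↔ ∃ s, eval a s ≠ 0 ∧ s * r ∈ tjurinaIdeal g := by
  rw [toTjurina_apply, TjurinaAlgebra.mk_eq_zero_iff,
    IsLocalization.mem_map_algebraMap_iff (RingHom.ker (eval a)).primeCompl]
  constructor
  · rintro ⟨⟨⟨t, ht⟩, ⟨s, hs⟩⟩, h⟩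
    refine ⟨s, hs, ?_⟩
    rw [← map_mul] at h
    have h1 := IsLocalization.injective (LocalRingAt a)
      (Ideal.primeCompl_le_nonZeroDivisors (RingHom.ker (eval (R := ℂ) a))) h
    rw [mul_comm, h1]
    exact ht
  · rintro ⟨s, hs, h⟩
    exact ⟨⟨⟨s * r, h⟩, ⟨s, hs⟩⟩, by rw [← map_mul, mul_comm]⟩

theorem exists_toTjurina_mul_eq (α : TjurinaAlgebra g a) :
    ∃ r s, eval a s ≠ 0 ∧ toTjurina g a s * α = toTjurina g a r := by
  obtain ⟨β, rfl⟩ := TjurinaAlgebra.mk_surjective g a α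
  obtain ⟨⟨r, s, hs⟩, h⟩ := IsLocalization.surj (RingHom.ker (eval a)).primeCompl β
  refine ⟨r, s, hs, ?_⟩
  rw [toTjurina_apply, toTjurina_apply, ← h, map_mul, mul_comm]

/-- The Jacobson radical of an Artinian ring is nilpotent. Using it instead of a maximal ideal also
covers a zero quotient, as occurs at nonsingular points. -/
theorem isNilpotent_toTjurina [Module.Finite ℂ (TjurinaAlgebra g a)]
    {r : MvPolynomial (Fin 2) ℂ} (hr : eval a r = 0) : IsNilpotent (toTjurina g a r) := by
  have : IsArtinianRing (TjurinaAlgebra g a) := IsArtinianRing.of_finite ℂ _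
  have hmem : toTjurina g a r ∈ (⊥ : Ideal (TjurinaAlgebra g a)).jacobson := by
    refine Ideal.mem_jacobson_bot.2 fun y => ?_
    obtain ⟨y, rfl⟩ := TjurinaAlgebra.mk_surjective g a y
    rw [toTjurina_apply, ← map_mul, ← map_one (TjurinaAlgebra.mk g a), ← map_add]
    have h1 : algebraMap _ (LocalRingAt a) r ∈ (⊥ : Ideal (LocalRingAt a)).jacobson := by
      rw [IsLocalRing.jacobson_eq_maximalIdeal _ bot_ne_top]
      exact (IsLocalization.AtPrime.to_map_mem_maximal_iff _ (RingHom.ker (eval a)) r).2 hr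
    exact (Ideal.mem_jacobson_bot.1 h1 y).map _
  obtain ⟨n, hn⟩ := IsArtinianRing.isNilpotent_jacobson_bot (R := TjurinaAlgebra g a)
  refine ⟨n, ?_⟩
  have := Ideal.pow_mem_pow hmem n
  rwa [hn] at this

theorem nontrivial_tjurinaAlgebra (h : ∀ r ∈ tjurinaIdeal g, eval a r = 0) :
    Nontrivial (TjurinaAlgebra g a) := by
  refine ⟨⟨toTjurina g a 1, 0, fun h1 => ?_⟩⟩
  obtain ⟨s, hs, hs'⟩ := toTjurina_eq_zero_iff.1 h1
  exact hs (by simpa using h _ hs')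

end LocalAlgebra

/-! ### Representing local classes by forms -/

section FormsToLocal

/-- A linear map on forms of degree `k` which vanishes on the ideal has rank at most
`dimQuotient I k`, with equality if the kernel is the ideal. -/
theorem finrank_range_le_dimQuotient {V : Type*} [AddCommGroup V] [Module ℂ V] {I : Ideal S}
    {k : ℕ} (ψ : homogeneousSubmodule (Fin 3) ℂ k →ₗ[ℂ] V)
    (h : ∀ p : homogeneousSubmodule (Fin 3) ℂ k, (p : S) ∈ I → ψ p = 0) :
    Module.finrank ℂ (LinearMap.range ψ) ≤ dimQuotient I k := by
  have hle : (I.restrictScalars ℂ).submoduleOf (homogeneousSubmodule (Fin 3) ℂ k) ≤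
      LinearMap.ker ψ := fun p hp => h p hp
  rw [← Submodule.range_liftQ _ ψ hle]
  exact LinearMap.finrank_range_le _

theorem finrank_range_eq_dimQuotient {V : Type*} [AddCommGroup V] [Module ℂ V] {I : Ideal S}
    {k : ℕ} (ψ : homogeneousSubmodule (Fin 3) ℂ k →ₗ[ℂ] V) (h : ∀ p, ψ p = 0 ↔ (p : S) ∈ I) :
    Module.finrank ℂ (LinearMap.range ψ) = dimQuotient I k := by
  have hker : (I.restrictScalars ℂ).submoduleOf (homogeneousSubmodule (Fin 3) ℂ k) =
      LinearMap.ker ψ := by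
    ext p
    exact (h p).symm
  rw [dimQuotient, hker]
  exact ψ.quotKerEquivRange.finrank_eq.symm

/-- The map from forms to the Tjurina algebra of the curve `f = 0` at a point of the `i`-th
chart. -/
noncomputable def formToTjurina (f : S) (i : Fin 3) (a : Fin 2 → ℂ) :
    S →ₐ[ℂ] TjurinaAlgebra (dehom i f) a :=
  (toTjurina (dehom i f) a).comp (dehom i)

theorem formToTjurina_apply (f : S) (i : Fin 3) (a : Fin 2 → ℂ) (F : S) :
    formToTjurina f i a F = toTjurina (dehom i f) a (dehom i F) := rfl

theorem formToTjurina_eq_zero (hd : d ≠ 0) (hf : f.IsHomogeneous d) (i : Fin 3) (a : Fin 2 → ℂ)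
    {F : S} (hF : F ∈ jacobianIdeal f) : formToTjurina f i a F = 0 := by
  rw [formToTjurina_apply, toTjurina_eq_zero_iff]
  refine ⟨1, by simp, ?_⟩
  rw [tjurinaIdeal_dehom hd hf, one_mul]
  exact Ideal.mem_map_of_mem _ hF

/-- The image of forms of degree `n` in the Tjurina algebra. -/
noncomputable def imageForms (f : S) (i : Fin 3) (a : Fin 2 → ℂ) (n : ℕ) :
    Submodule ℂ (TjurinaAlgebra (dehom i f) a) :=
  (homogeneousSubmodule (Fin 3) ℂ n).map (formToTjurina f i a).toLinearMap

theorem mem_imageForms {i : Fin 3} {a : Fin 2 → ℂ} {n : ℕ} {α : TjurinaAlgebra (dehom i f) a} :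
    α ∈ imageForms f i a n ↔ ∃ F : S, F.IsHomogeneous n ∧ formToTjurina f i a F = α := Iff.rfl

instance finite_imageForms (i : Fin 3) (a : Fin 2 → ℂ) (n : ℕ) :
    Module.Finite ℂ (imageForms f i a n) := by
  unfold imageForms; infer_instance

/-- Multiplication by `X i`, which dehomogenizes to 1, raises the degree without changing the class.
-/
theorem imageForms_mono (i : Fin 3) (a : Fin 2 → ℂ) : Monotone (imageForms f i a) := by
  refine monotone_nat_of_le_succ fun n α hα => ?_
  obtain ⟨F, hF, rfl⟩ := mem_imageForms.1 hα
  exact mem_imageForms.2 ⟨F * X i, hF.mul (isHomogeneous_X ℂ i), by simp [formToTjurina]⟩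

theorem finrank_imageForms_le (hd : d ≠ 0) (hf : f.IsHomogeneous d) (i : Fin 3) (a : Fin 2 → ℂ)
    (n : ℕ) : Module.finrank ℂ (imageForms f i a n) ≤ dimMilnor f n := by
  have h := finrank_range_le_dimQuotient (I := jacobianIdeal f) (k := n)
    ((formToTjurina f i a).toLinearMap.domRestrict _)
    fun p hp => formToTjurina_eq_zero hd hf i a hp
  rwa [LinearMap.range_domRestrict] at h

/-- If the Hilbert function of the Milnor algebra is bounded, then every element of the local
Tjurina algebra is represented by a form of any large degree. -/
theorem exists_imageForms_eq_top (hd : d ≠ 0) (hf : f.IsHomogeneous d) (i : Fin 3) (a : Fin 2 → ℂ)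
    {T n₀ : ℕ} (hT : ∀ n, n₀ ≤ n → dimMilnor f n ≤ T) :
    ∃ N, ∀ n, N ≤ n → imageForms f i a n = ⊤ := by
  have hbound : ∀ n, Module.finrank ℂ (imageForms f i a n) ≤ T := fun n =>
    (Submodule.finrank_mono (imageForms_mono i a (le_max_left n n₀))).trans
      ((finrank_imageForms_le hd hf i a _).trans (hT _ (le_max_right n n₀)))
  obtain ⟨N, hN⟩ : ∃ N, ∀ n, Module.finrank ℂ (imageForms f i a n) ≤
      Module.finrank ℂ (imageForms f i a N) := by
    have hfin : (Set.range fun n => Module.finrank ℂ (imageForms f i a n)).Finite :=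
      (Set.finite_Iic T).subset (by rintro _ ⟨n, rfl⟩; exact hbound n)
    obtain ⟨_, ⟨N, rfl⟩, h⟩ := Set.exists_max_image _ id hfin ⟨_, 0, rfl⟩
    exact ⟨N, fun n => h _ ⟨n, rfl⟩⟩
  have hstab : ∀ n, N ≤ n → imageForms f i a N = imageForms f i a n := fun n hn =>
    Submodule.eq_of_le_of_finrank_le (imageForms_mono i a hn) (hN n)
  have hpoly : ∀ r, toTjurina (dehom i f) a r ∈ imageForms f i a N := by
    intro r
    obtain ⟨M, hM⟩ := exists_form_dehom_eq i r
    obtain ⟨F, hF, rfl⟩ := hM (max M N) (le_max_left _ _)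
    rw [hstab _ (le_max_right M N)]
    exact mem_imageForms.2 ⟨F, hF, rfl⟩
  refine ⟨N, fun n hn => ?_⟩
  rw [← hstab n hn, eq_top_iff]
  intro α _
  obtain ⟨r, s, hs, hrs⟩ := exists_toTjurina_mul_eq α
  have hu : IsUnit (toTjurina (dehom i f) a s) := isUnit_toTjurina hs
  have hmaps : ∀ β ∈ imageForms f i a N,
      LinearMap.mulLeft ℂ (toTjurina (dehom i f) a s) β ∈ imageForms f i a N := by
    intro β hβ
    obtain ⟨F, hF, rfl⟩ := mem_imageForms.1 hβ
    rw [LinearMap.mulLeft_apply, formToTjurina_apply, ← map_mul]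
    exact hpoly _
  -- A unit acting injectively on the finite-dimensional stable image acts surjectively, so
  -- fractions `r / s` are reached as well as polynomials.
  have hinj : Function.Injective
      ((LinearMap.mulLeft ℂ (toTjurina (dehom i f) a s)).restrict hmaps) := by
    intro β γ h
    exact Subtype.ext (hu.mul_left_cancel (congrArg Subtype.val h))
  obtain ⟨β, hβ⟩ := LinearMap.injective_iff_surjective.1 hinj ⟨_, hpoly r⟩
  have h2 : toTjurina (dehom i f) a s * β = toTjurina (dehom i f) a r := congrArg Subtype.val hβ
  rw [← hrs] at h2
  rw [← hu.mul_left_cancel h2]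
  exact β.2

/-- A form which vanishes in the Tjurina algebra at a point is multiplied into the Jacobian ideal
by a form which does not vanish at the point. -/
theorem exists_form_mul_mem (hd : d ≠ 0) (hf : f.IsHomogeneous d) {i : Fin 3} {x : Fin 3 → ℂ}
    (hx : x i ≠ 0) {F : S} {k : ℕ} (hF : F.IsHomogeneous k)
    (h0 : formToTjurina f i (affinePoint i x) F = 0) :
    ∃ (H : S) (n : ℕ), H.IsHomogeneous n ∧ eval x H ≠ 0 ∧ H * F ∈ jacobianIdeal f := by
  rw [formToTjurina_apply, toTjurina_eq_zero_iff] at h0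
  obtain ⟨s, hs, hsF⟩ := h0
  rw [tjurinaIdeal_dehom hd hf, Ideal.mem_map_iff_of_surjective _
    fun s => ⟨_, dehom_rename i s⟩] at hsF
  obtain ⟨G, hG, hGs⟩ := hsF
  obtain ⟨c, rfl⟩ := mem_jacobianIdeal.1 hG
  choose N hN using fun j => exists_form_dehom_eq i (dehom i (c j))
  obtain ⟨M, hM⟩ := exists_form_dehom_eq i s
  -- Large enough to homogenize `s` in degree `m` and the coefficients in degree `m + k - (d - 1)`,
  -- so that both sides have degree `m + k` and can be compared in the chart.
  set m := max (M + d) (Finset.univ.sup N + d) with hm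
  obtain ⟨H, hH, rfl⟩ := hM m (by omega)
  have hc : ∀ j, ∃ P : S, P.IsHomogeneous (m + k - (d - 1)) ∧ dehom i P = dehom i (c j) :=
    fun j => hN j _ (by have := Finset.le_sup (f := N) (Finset.mem_univ j); omega)
  choose P hP hPc using hc
  refine ⟨H, m, hH, ?_, mem_jacobianIdeal.2 ⟨P, ?_⟩⟩
  · rw [← eval_dehom hx hH]
    exact mul_ne_zero (pow_ne_zero _ hx) hs
  · rw [← sub_eq_zero]
    have hhom : (∑ j, P j * pderiv j f - H * F).IsHomogeneous (m + k) := by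
      refine IsHomogeneous.sub (IsHomogeneous.sum _ _ _ fun j _ => ?_) (hH.mul hF)
      have := (hP j).mul (hf.pderiv (i := j))
      rwa [Nat.sub_add_cancel (by omega)] at this
    refine eq_zero_of_dehom_eq_zero (i := i) hhom ?_
    rw [map_sub, map_mul, ← hGs, map_sum, map_sum]
    simp only [map_mul, hPc, sub_self]

end FormsToLocal

/-! ### Globalization: the eventual Hilbert function is the total Tjurina number -/

/-- The Tjurina algebra of the curve `f = 0` at a point of the projective plane. -/
abbrev TjurinaAlgebraAt (f : S) (p : ℙ ℂ (Fin 3 → ℂ)) : Type :=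
  TjurinaAlgebra (dehom (chartIndex p) f) (affinePoint (chartIndex p) p.rep)

/-- The map from polynomials to the Tjurina algebra at a point of the projective plane. -/
noncomputable abbrev formAt (f : S) (p : ℙ ℂ (Fin 3 → ℂ)) : S →ₐ[ℂ] TjurinaAlgebraAt f p :=
  formToTjurina f (chartIndex p) (affinePoint (chartIndex p) p.rep)

theorem finrank_tjurinaAlgebraAt (f : S) (p : ℙ ℂ (Fin 3 → ℂ)) :
    Module.finrank ℂ (TjurinaAlgebraAt f p) = tjurinaAt f p := rfl

theorem eval_affinePoint_eq_zero_iff (p : ℙ ℂ (Fin 3 → ℂ)) {F : S} {n : ℕ}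
    (hF : F.IsHomogeneous n) :
    eval (affinePoint (chartIndex p) p.rep) (dehom (chartIndex p) F) = 0 ↔ eval p.rep F = 0 := by
  rw [← eval_dehom (rep_chartIndex_ne_zero p) hF, mul_eq_zero,
    or_iff_right (pow_ne_zero _ (rep_chartIndex_ne_zero p))]

theorem isUnit_formAt {p : ℙ ℂ (Fin 3 → ℂ)} {F : S} {n : ℕ} (hF : F.IsHomogeneous n)
    (h : eval p.rep F ≠ 0) : IsUnit (formAt f p F) :=
  isUnit_toTjurina ((eval_affinePoint_eq_zero_iff p hF).not.2 h)

theorem isNilpotent_formAt {p : ℙ ℂ (Fin 3 → ℂ)} [Module.Finite ℂ (TjurinaAlgebraAt f p)] {F : S}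
    {n : ℕ} (hF : F.IsHomogeneous n) (h : eval p.rep F = 0) : IsNilpotent (formAt f p F) :=
  isNilpotent_toTjurina ((eval_affinePoint_eq_zero_iff p hF).2 h)

theorem nontrivial_tjurinaAlgebraAt (hd : d ≠ 0) (hf : f.IsHomogeneous d) {p : ℙ ℂ (Fin 3 → ℂ)}
    (hp : p ∈ singularPoints f) : Nontrivial (TjurinaAlgebraAt f p) := by
  refine nontrivial_tjurinaAlgebra fun r hr => ?_
  have hle : tjurinaIdeal (dehom (chartIndex p) f) ≤
      RingHom.ker (eval (affinePoint (chartIndex p) p.rep)) := by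
    rw [tjurinaIdeal_dehom hd hf, Ideal.map_le_iff_le_comap, jacobianIdeal, Ideal.span_le]
    rintro _ ⟨k, rfl⟩
    exact (eval_affinePoint_eq_zero_iff p hf.pderiv).2 (hp.2 k)
  exact hle hr

theorem exists_linear_form {p q : ℙ ℂ (Fin 3 → ℂ)} (hpq : p ≠ q) :
    ∃ L : S, L.IsHomogeneous 1 ∧ eval q.rep L = 0 ∧ eval p.rep L ≠ 0 := by
  by_contra! h
  have h1 : ∀ i j, q.rep j * p.rep i = q.rep i * p.rep j := by
    intro i j
    have h2 := h (C (q.rep j) * X i - C (q.rep i) * X j)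
      (((isHomogeneous_X ℂ i).C_mul _).sub ((isHomogeneous_X ℂ j).C_mul _))
      (by simp [mul_comm])
    simpa [sub_eq_zero] using h2
  have hq := rep_chartIndex_ne_zero q
  apply hpq
  rw [← p.mk_rep, ← q.mk_rep, Projectivization.mk_eq_mk_iff']
  refine ⟨p.rep (chartIndex q) / q.rep (chartIndex q), funext fun i => ?_⟩
  rw [Pi.smul_apply, smul_eq_mul, div_mul_eq_mul_div, div_eq_iff hq, mul_comm (p.rep i), h1,
    mul_comm]

theorem finite_tjurinaAlgebraAt (hd : d ≠ 0) (hf : f.IsHomogeneous d) {T n₀ : ℕ}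
    (hT : ∀ n, n₀ ≤ n → dimMilnor f n ≤ T)
    (p : ℙ ℂ (Fin 3 → ℂ)) :
    Module.Finite ℂ (TjurinaAlgebraAt f p) := by
  obtain ⟨N, hN⟩ := exists_imageForms_eq_top hd hf (chartIndex p)
    (affinePoint (chartIndex p) p.rep) hT
  have h : (⊤ : Submodule ℂ (TjurinaAlgebraAt f p)).FG := by
    rw [← hN N le_rfl]
    exact Module.Finite.iff_fg.1 inferInstance
  exact ⟨h⟩

/-- For each `q` take a linear form through `q` missing `p`: it is nilpotent at `q` and a unit at
`p`, so a product of powers works. -/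
theorem exists_separating_form (hd : d ≠ 0) (hf : f.IsHomogeneous d) {T n₀ : ℕ}
    (hT : ∀ n, n₀ ≤ n → dimMilnor f n ≤ T)
    (p : ℙ ℂ (Fin 3 → ℂ)) (F : Finset (ℙ ℂ (Fin 3 → ℂ))) (hp : p ∉ F) :
    ∃ (E : S) (n : ℕ), E.IsHomogeneous n ∧ IsUnit (formAt f p E) ∧ ∀ q ∈ F, formAt f q E = 0 := by
  classical
  induction F using Finset.induction_on with
  | empty => exact ⟨1, 0, isHomogeneous_one _ _, by simp, by simp⟩
  | insert q F hq ih =>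
    rw [Finset.mem_insert, not_or] at hp
    obtain ⟨E, n, hE, hu, h0⟩ := ih hp.2
    obtain ⟨L, hL, hLq, hLp⟩ := exists_linear_form hp.1
    have := finite_tjurinaAlgebraAt hd hf hT q
    obtain ⟨N, hN⟩ := isNilpotent_formAt (f := f) hL hLq
    refine ⟨E * L ^ N, n + 1 * N, hE.mul (hL.pow N), ?_, fun r hr => ?_⟩
    · rw [map_mul, map_pow]
      exact hu.mul ((isUnit_formAt hL hLp).pow N)
    · rw [map_mul, map_pow]
      rcases Finset.mem_insert.1 hr with rfl | hr
      · rw [hN, mul_zero]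
      · rw [h0 r hr, zero_mul]

theorem exists_form_single (hd : d ≠ 0) (hf : f.IsHomogeneous d) {T n₀ : ℕ}
    (hT : ∀ n, n₀ ≤ n → dimMilnor f n ≤ T)
    (p : ℙ ℂ (Fin 3 → ℂ)) (F : Finset (ℙ ℂ (Fin 3 → ℂ))) :
    ∃ K, ∀ k, K ≤ k → ∀ α : TjurinaAlgebraAt f p, ∃ G : S, G.IsHomogeneous k ∧
      formAt f p G = α ∧ ∀ q ∈ F, q ≠ p → formAt f q G = 0 := by
  classical
  obtain ⟨E, n, hE, hu, h0⟩ := exists_separating_form hd hf hT p (F.erase p) (by simp)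
  obtain ⟨N, hN⟩ := exists_imageForms_eq_top hd hf (chartIndex p)
    (affinePoint (chartIndex p) p.rep) hT
  refine ⟨N + n, fun k hk α => ?_⟩
  obtain ⟨u, hu⟩ := hu
  have hmem : (↑u⁻¹ : TjurinaAlgebraAt f p) * α ∈ imageForms f (chartIndex p)
      (affinePoint (chartIndex p) p.rep) (k - n) := by
    rw [hN _ (by omega)]; trivial
  obtain ⟨G, hG, hGα⟩ := mem_imageForms.1 hmem
  refine ⟨E * G, ?_, ?_, fun q hq hqp => ?_⟩
  · have := hE.mul hG
    rwa [Nat.add_sub_cancel' (by omega)] at this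
  · rw [map_mul, hGα, ← hu, Units.mul_inv_cancel_left]
  · rw [map_mul, h0 q (Finset.mem_erase.2 ⟨hqp, hq⟩), zero_mul]

/-- The map from forms to the product of Tjurina algebras at finitely many points. -/
noncomputable def formsToPi (f : S) (F : Finset (ℙ ℂ (Fin 3 → ℂ))) (k : ℕ) :
    homogeneousSubmodule (Fin 3) ℂ k →ₗ[ℂ] ((p : F) → TjurinaAlgebraAt f p) :=
  LinearMap.pi fun p => (formAt f p).toLinearMap.domRestrict _

theorem formsToPi_apply (F : Finset (ℙ ℂ (Fin 3 → ℂ))) (k : ℕ)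
    (G : homogeneousSubmodule (Fin 3) ℂ k) (p : F) : formsToPi f F k G p = formAt f p G := rfl

theorem formsToPi_eq_zero_iff {F : Finset (ℙ ℂ (Fin 3 → ℂ))} {k : ℕ}
    {G : homogeneousSubmodule (Fin 3) ℂ k} :
    formsToPi f F k G = 0 ↔ ∀ p ∈ F, formAt f p G = 0 :=
  funext_iff.trans Subtype.forall

theorem formsToPi_eq_zero (hd : d ≠ 0) (hf : f.IsHomogeneous d) {F : Finset (ℙ ℂ (Fin 3 → ℂ))}
    {k : ℕ} {G : homogeneousSubmodule (Fin 3) ℂ k} (hG : (G : S) ∈ jacobianIdeal f) :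
    formsToPi f F k G = 0 :=
  formsToPi_eq_zero_iff.2 fun _ _ => formToTjurina_eq_zero hd hf _ _ hG

theorem exists_formsToPi_surjective (hd : d ≠ 0) (hf : f.IsHomogeneous d) {T n₀ : ℕ}
    (hT : ∀ n, n₀ ≤ n → dimMilnor f n ≤ T)
    (F : Finset (ℙ ℂ (Fin 3 → ℂ))) :
    ∃ K, ∀ k, K ≤ k → LinearMap.range (formsToPi f F k) = ⊤ := by
  classical
  choose K hK using fun p : F => exists_form_single hd hf hT p.1 F
  refine ⟨Finset.univ.sup K, fun k hk => LinearMap.range_eq_top.2 fun α => ?_⟩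
  choose G hG hGα hG0 using fun p : F =>
    hK p k ((Finset.le_sup (Finset.mem_univ p)).trans hk) (α p)
  refine ⟨∑ p, ⟨G p, hG p⟩, funext fun q => ?_⟩
  rw [map_sum, Finset.sum_apply, Finset.sum_eq_single q, formsToPi_apply, hGα]
  · intro p _ hp
    rw [formsToPi_apply]
    exact hG0 p q q.2 fun h => hp (Subtype.ext h.symm)
  · simp

theorem finrank_pi_tjurinaAlgebraAt (hd : d ≠ 0) (hf : f.IsHomogeneous d) {T n₀ : ℕ}
    (hT : ∀ n, n₀ ≤ n → dimMilnor f n ≤ T)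
    (F : Finset (ℙ ℂ (Fin 3 → ℂ))) :
    Module.finrank ℂ ((p : F) → TjurinaAlgebraAt f p) = ∑ p ∈ F, tjurinaAt f p := by
  have := finite_tjurinaAlgebraAt hd hf hT
  rw [Module.finrank_pi_fintype]
  exact Finset.sum_coe_sort F (tjurinaAt f)

/-- Each singular point contributes at least 1 to the dimension of a quotient of M(f)_k for large
`k`, so there are at most `T` of them. -/
theorem finite_singularPoints (hd : d ≠ 0) (hf : f.IsHomogeneous d) {T n₀ : ℕ}
    (hT : ∀ n, n₀ ≤ n → dimMilnor f n ≤ T) :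
    (singularPoints f).Finite := by
  by_contra hinf
  obtain ⟨F, hF, hcard⟩ := Set.Infinite.exists_subset_card_eq hinf (T + 1)
  obtain ⟨K, hK⟩ := exists_formsToPi_surjective hd hf hT F
  have h1 := finrank_range_le_dimQuotient (I := jacobianIdeal f) (formsToPi f F (max K n₀))
    fun _ hG => formsToPi_eq_zero hd hf hG
  rw [hK _ (le_max_left _ _), finrank_top, finrank_pi_tjurinaAlgebraAt hd hf hT] at h1
  have h2 : ∑ p ∈ F, 1 ≤ ∑ p ∈ F, tjurinaAt f p := by
    refine Finset.sum_le_sum fun p hp => ?_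
    have := finite_tjurinaAlgebraAt hd hf hT p
    have := nontrivial_tjurinaAlgebraAt hd hf (hF hp)
    rw [← finrank_tjurinaAlgebraAt]
    exact Module.finrank_pos
  rw [Finset.sum_const, hcard, smul_eq_mul, mul_one] at h2
  have h3 := hT _ (le_max_right K n₀)
  rw [dimMilnor] at h3
  omega

/-- A form which vanishes in all Tjurina algebras belongs to the saturation of the Jacobian
ideal. -/
theorem mem_saturation_of_formAt_eq_zero (hd : d ≠ 0) (hf : f.IsHomogeneous d) {F : S} {k : ℕ}
    (hF : F.IsHomogeneous k) (h : ∀ p ∈ singularPoints f, formAt f p F = 0) :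
    F ∈ saturation (jacobianIdeal f) := by
  -- The ideal quotient of J_f by `F`. Its only possible zero is the origin, so by the
  -- Nullstellensatz it contains a power of (x, y, z).
  set Q : Ideal S := Submodule.comap (LinearMap.toSpanSingleton S S F) (jacobianIdeal f) with hQ
  have hmem : ∀ g, g ∈ Q ↔ g * F ∈ jacobianIdeal f := fun g => Iff.rfl
  have hzero : ∀ x ∈ zeroLocus ℂ Q, x = 0 := by
    intro x hx
    by_contra hx0
    obtain ⟨c, hc⟩ := Projectivization.exists_smul_eq_mk_rep ℂ x hx0
    rw [Units.smul_def] at hc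
    set p := Projectivization.mk ℂ x hx0
    have hrep : ∀ {G : S} {n : ℕ}, G.IsHomogeneous n → G ∈ Q → eval p.rep G = 0 := by
      intro G n hG hGQ
      have h1 : eval x G = 0 := by
        have := mem_zeroLocus_iff.1 hx G hGQ
        rwa [aeval_eq_eval] at this
      rw [← hc, eval_smul_of_isHomogeneous hG, h1, mul_zero]
    have hpd : ∀ i, eval p.rep (pderiv i f) = 0 := fun i =>
      hrep hf.pderiv ((hmem _).2 (Ideal.mul_mem_right _ _ (Ideal.subset_span ⟨i, rfl⟩)))
    have hpf : eval p.rep f = 0 := by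
      have h1 := congrArg (eval p.rep) hf.sum_X_mul_pderiv
      simp only [map_sum, map_mul, hpd, mul_zero, Finset.sum_const_zero, nsmul_eq_mul,
        map_natCast] at h1
      exact (mul_eq_zero.1 h1.symm).resolve_left (Nat.cast_ne_zero.2 hd)
    obtain ⟨H, n, hH, hHp, hHF⟩ := exists_form_mul_mem hd hf (rep_chartIndex_ne_zero p) hF
      (h p ⟨hpf, hpd⟩)
    exact hHp (hrep hH ((hmem H).2 hHF))
  have hrad : Ideal.span (Set.range (X : Fin 3 → S)) ≤ Q.radical := by
    rw [← vanishingIdeal_zeroLocus_eq_radical (K := ℂ), Ideal.span_le]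
    rintro _ ⟨i, rfl⟩
    refine mem_vanishingIdeal_iff.2 fun x hx => ?_
    rw [hzero x hx, aeval_X, Pi.zero_apply]
  obtain ⟨n, hn⟩ := Ideal.exists_pow_le_of_le_radical_of_fg hrad
    (Submodule.fg_span (Set.finite_range _))
  exact ⟨n, fun g hg => (hmem g).1 (hn hg)⟩

/-- If the Jacobian ideal is saturated and its Hilbert function is bounded, then the Hilbert
function takes the value `τ` in all large degrees. -/
theorem exists_dimMilnor_eq_totalTjurina (hd : d ≠ 0) (hf : f.IsHomogeneous d) {T n₀ : ℕ}
    (hT : ∀ n, n₀ ≤ n → dimMilnor f n ≤ T)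
    (hsat : saturation (jacobianIdeal f) = jacobianIdeal f) :
    ∃ K, ∀ k, K ≤ k → dimMilnor f k = totalTjurina f := by
  have hfin := finite_singularPoints hd hf hT
  obtain ⟨K, hK⟩ := exists_formsToPi_surjective hd hf hT hfin.toFinset
  refine ⟨K, fun k hk => ?_⟩
  have h1 := finrank_range_eq_dimQuotient (I := jacobianIdeal f) (formsToPi f hfin.toFinset k)
    fun G => ⟨fun h => by
      rw [← hsat]
      exact mem_saturation_of_formAt_eq_zero hd hf G.2 fun p hp =>
        formsToPi_eq_zero_iff.1 h p (hfin.mem_toFinset.2 hp),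
      fun hG => formsToPi_eq_zero hd hf hG⟩
  rw [dimMilnor, ← h1, hK k hk, finrank_top, finrank_pi_tjurinaAlgebraAt hd hf hT, totalTjurina,
    finsum_mem_eq_finite_toFinset_sum _ hfin]

end PlaneCurve

/-! ### Conclusion -/

theorem corollary4p3 (d : ℕ) (hd : 3 ≤ d) (f : MvPolynomial (Fin 3) ℂ)
    (hf : f.IsHomogeneous d) (hred : Squarefree f) (d₁ d₂ : ℕ)
    (hfree : PlaneCurve.IsFreeWithExponents f d₁ d₂) :
    ∃ k₁ : ℕ, (k₁ : ℤ) = 2 * (d : ℤ) - 5 - (d₁ : ℤ) ∧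
      (∀ k : ℕ, k₁ < k →
        PlaneCurve.defect f k =
            (PlaneCurve.totalTjurina f : ℤ) - (PlaneCurve.dimMilnor f k : ℤ) ∧
          (PlaneCurve.totalTjurina f : ℤ) - (PlaneCurve.dimMilnor f k : ℤ) = 0) ∧
      PlaneCurve.defect f k₁ =
          (PlaneCurve.totalTjurina f : ℤ) - (PlaneCurve.dimMilnor f k₁ : ℤ) ∧
        0 < (PlaneCurve.totalTjurina f : ℤ) - (PlaneCurve.dimMilnor f k₁ : ℤ) := by
  obtain ⟨ρ, hρ⟩ := hfree
  have hd0 : d ≠ 0 := by omega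
  have h12 : d₁ ≤ d₂ := hρ.monotone (show (0 : Fin 2) ≤ 1 by decide)
  have hind : ∀ a b : PlaneCurve.S, a • ρ 0 + b • ρ 1 = 0 → a = 0 ∧ b = 0 := fun _ _ =>
    PlaneCurve.eq_zero_of_smul_add_smul_eq_zero
      (PlaneCurve.cross_ne_zero hρ.span_eq (PlaneCurve.exists_pderiv_ne_zero hd0 hf hred))
  have hhilb : ∀ k, PlaneCurve.dimMilnor f k + 3 * (k + 2 - (d - 1)).choose 2 =
      (k + 2).choose 2 + (k + 2 - (d - 1 + d₁)).choose 2 + (k + 2 - (d - 1 + d₂)).choose 2 :=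
    fun k => PlaneCurve.dimMilnor_add hf k hρ.span_eq hρ.homogeneous hind
  have hsum : d₁ + d₂ = d - 1 :=
    le_antisymm (PlaneCurve.add_le_of_hilbert hhilb)
      (PlaneCurve.le_add_of_generators hd0 hf hred hρ.span_eq (hρ.homogeneous 0)
        (hρ.homogeneous 1))
  have hsat : PlaneCurve.saturation (PlaneCurve.jacobianIdeal f) = PlaneCurve.jacobianIdeal f :=
    PlaneCurve.saturation_eq_self fun g =>
      PlaneCurve.mem_jacobianIdeal_of_X_mul_mem hρ.span_eq hind
  have hdef : ∀ k, PlaneCurve.defect f k =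
      (PlaneCurve.totalTjurina f : ℤ) - (PlaneCurve.dimMilnor f k : ℤ) := fun k => by
    rw [PlaneCurve.defect, hsat, PlaneCurve.dimMilnor]
  -- By `hsum` this is 2d - 5 - d₁; it is non-negative because `d₂` is the larger of two exponents
  -- with sum at least 2.
  obtain ⟨k₁, hk₁⟩ : ∃ k₁, d - 1 + d₂ = k₁ + 3 := ⟨d - 1 + d₂ - 3, by omega⟩
  have hconst : ∀ k, k₁ < k → PlaneCurve.dimMilnor f k = PlaneCurve.dimMilnor f (k₁ + 1) :=
    fun k hk => PlaneCurve.hilbert_eq_const hhilb hsum h12 (by omega) (by omega)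
  obtain ⟨K, hK⟩ := PlaneCurve.exists_dimMilnor_eq_totalTjurina hd0 hf
    (fun n (hn : k₁ + 1 ≤ n) => (hconst n hn).le) hsat
  -- Compare the two eventual values in a degree beyond both thresholds.
  have hτ : PlaneCurve.totalTjurina f = PlaneCurve.dimMilnor f (k₁ + 1) := by
    rw [← hK (max K (k₁ + 1)) (le_max_left _ _)]
    exact hconst _ (Nat.lt_of_succ_le (le_max_right _ _))
  have hlt := PlaneCurve.hilbert_lt hhilb hsum h12 (by omega) hk₁
  refine ⟨k₁, by omega, fun k hk => ⟨hdef k, ?_⟩, hdef k₁, ?_⟩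
  · rw [hτ, hconst k hk, sub_self]
  · rw [hτ]
    omega
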